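/- Let $n\ge 1$, let $K$ be a field of characteristic $0$, and let $x_1,\dots,x_n$ be indeterminates over $K$; write $\overline{x}_i=x_i^{-1}$. Let $c=(c_m)_{m\in\mathbb{Z}}$ be a sequence of elements of $K$ (for example, with the $c_m$, $m\ge 0$, indeterminates over $\mathbb{Q}$), and assume that $c_m=0$ for all $m<0$. For a sequence $a=(a_m)_{m\in\mathbb{Z}}$ put $(y|a)^k=(y-a_0)(y-a_1)\cdots(y-a_{k-1})$ for $k\ge 0$, and $(\tau^r a)_m=a_{m+r}$ for $r\in\mathbb{Z}$. The complete factorial symmetric polynomials in $N\ge 1$ variables are defined for $k\ge 0$ by $$h_k(y_1,\dots,y_N|a)=\frac{\det\left[(y_i|a)^{\kappa_j+N-j}\right]_{i,j=1}^N}{\det\left[(y_i|a)^{N-j}\right]_{i,j=1}^N},\qquad \kappa=(k,0,\dots,0),$$ and $h_k(y_1,\dots,y_N|a)=0$ for $k<0$. For a partition $\lambda=(\lambda_1\ge\dots\ge\lambda_n\ge 0)$ the Foley–King factorial symplectic character is $$\mathrm{sp}_\lambda(x|c)=\frac{\det\left[x_i\,(x_i|c)^{\lambda_j+n-j}-\overline{x}_i\,(\overline{x}_i|c)^{\lambda_j+n-j}\right]_{i,j=1}^n}{\det\left[x_i\,(x_i|c)^{n-j}-\overline{x}_i\,(\overline{x}_i|c)^{n-j}\right]_{i,j=1}^n}.$$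 Then, in $K(x_1,\dots,x_n)$, $$\mathrm{sp}_\lambda(x|c)=\frac12\det\left[h_{\lambda_i-i+j}(x,\overline{x}|\tau^{1-n-j}c)+h_{\lambda_i-i-j+2}(x,\overline{x}|\tau^{-1-n+j}c)\right]_{i,j=1}^n,$$ where $h_k(x,\overline{x}|\cdot)$ is taken in the $2n$ variables $x_1,\dots,x_n,\overline{x}_1,\dots,\overline{x}_n$. -/

import Mathlib

namespace FactorialCharacter

variable {F : Type*} [Field F]

/-- The factorial power `(x|c)^k = (x - c_0)(x - c_1) ⋯ (x - c_{k-1})`, for `k ≥ 0`. -/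
def factorialPow (c : ℤ → F) (x : F) (k : ℕ) : F :=
  ∏ l ∈ Finset.range k, (x - c (l : ℤ))

/-- The shift operator on doubly infinite sequences: `(τ^r c)_m = c_{m + r}`. -/
def shift (r : ℤ) (c : ℤ → F) : ℤ → F :=
  fun m => c (m + r)

/-- The factorial Schur function `s_μ(x_1, …, x_N | c)` as a ratio of alternants,
`det [(x_i|c)^{μ_j + N - j}] / det [(x_i|c)^{N - j}]`.
Indices in `Fin N` start from `0`, so the exponent `N - j` reads `N - 1 - j` here. -/
def factorialSchur {N : ℕ} (μ : Fin N → ℕ) (x : Fin N → F) (c : ℤ → F) : F :=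
  (Matrix.of fun i j : Fin N => factorialPow c (x i) (μ j + (N - 1 - (j : ℕ)))).det /
    (Matrix.of fun i j : Fin N => factorialPow c (x i) (N - 1 - (j : ℕ))).det

/-- The complete factorial symmetric polynomial `h_k(x_1, …, x_N | c)`: it is
`s_{(k, 0, …, 0)}(x_1, …, x_N | c)` for `k ≥ 0`, and `0` for `k < 0`. -/
def completeFactorial {N : ℕ} (k : ℤ) (x : Fin N → F) (c : ℤ → F) : F :=
  if 0 ≤ k then factorialSchur (fun j : Fin N => if (j : ℕ) = 0 then k.toNat else 0) x c
  else 0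

/-- The Foley–King factorial symplectic character `sp_μ(x_1, …, x_n | c)`, the ratio of
`det [x_i (x_i|c)^{μ_j + n - j} - x_i⁻¹ (x_i⁻¹|c)^{μ_j + n - j}]` and
`det [x_i (x_i|c)^{n - j} - x_i⁻¹ (x_i⁻¹|c)^{n - j}]`. -/
def factorialSp {n : ℕ} (μ : Fin n → ℕ) (x : Fin n → F) (c : ℤ → F) : F :=
  (Matrix.of fun i j : Fin n =>
      x i * factorialPow c (x i) (μ j + (n - 1 - (j : ℕ)))
        - (x i)⁻¹ * factorialPow c (x i)⁻¹ (μ j + (n - 1 - (j : ℕ)))).det /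
    (Matrix.of fun i j : Fin n =>
      x i * factorialPow c (x i) (n - 1 - (j : ℕ))
        - (x i)⁻¹ * factorialPow c (x i)⁻¹ (n - 1 - (j : ℕ))).det

/-- The list of `2n` variables `x_1, …, x_n, x_1⁻¹, …, x_n⁻¹`. -/
def withInverses {n : ℕ} (x : Fin n → F) : Fin (n + n) → F :=
  Fin.append x (fun i => (x i)⁻¹)

/-- The Jacobi–Trudi matrix of type C, with `(i, j)` entry
`h_{μ_i - i + j}(x, x⁻¹ | τ^{1 - n - j} c) + h_{μ_i - i - j + 2}(x, x⁻¹ | τ^{-1 - n + j} c)`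
for `1 ≤ i, j ≤ n`; the indices of `Fin n` start from `0`, whence the `+ 1`. -/
def jacobiTrudiC {n : ℕ} (μ : Fin n → ℕ) (x : Fin n → F) (c : ℤ → F) :
    Matrix (Fin n) (Fin n) F :=
  Matrix.of fun i j =>
    completeFactorial ((μ i : ℤ) - ((i : ℤ) + 1) + ((j : ℤ) + 1)) (withInverses x)
        (shift (1 - (n : ℤ) - ((j : ℤ) + 1)) c) +
      completeFactorial ((μ i : ℤ) - ((i : ℤ) + 1) - ((j : ℤ) + 1) + 2) (withInverses x)
        (shift (-1 - (n : ℤ) + ((j : ℤ) + 1)) c)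

/-- The field `K(x_1, …, x_n)` of rational functions over `K`. -/
abbrev RationalFunctions (K : Type*) [Field K] (n : ℕ) : Type _ :=
  FractionRing (MvPolynomial (Fin n) K)

/-- The indeterminates `x_1, …, x_n` in `K(x_1, …, x_n)`. -/
noncomputable def indeterminate (K : Type*) [Field K] (n : ℕ) (i : Fin n) :
    RationalFunctions K n :=
  algebraMap (MvPolynomial (Fin n) K) (RationalFunctions K n) (MvPolynomial.X i)

/-- A sequence in `K`, regarded as a sequence of constants in `K(x_1, …, x_n)`. -/
noncomputable def constSeq {K : Type*} [Field K] (n : ℕ) (c : ℤ → K) :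
    ℤ → RationalFunctions K n :=
  fun m => algebraMap (MvPolynomial (Fin n) K) (RationalFunctions K n) (MvPolynomial.C (c m))

end FactorialCharacter

/-!
Put `N = 2n` and let `y` run over the `2n` variables `x_1, …, x_n, x_1⁻¹, …, x_n⁻¹`.
Interpolating the first column of the numerator by a polynomial of degree `< N` shows that, for
`k > -N`, the complete factorial symmetric polynomial is a divided difference,
`h_k(y | a) = ∑_y (y|a)^{k + N - 1} / ∏_{z ≠ y} (y - z)` (`completeFactorial_eq_sum`).
Since `c` vanishes at negative indices, `(y|τ^{-r} c)^{r + m} = y^r (y|c)^m`, so that the `(i, j)`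
entry of the Jacobi–Trudi matrix is the divided difference of
`y^n (y^{j-1} + y^{1-j}) (y|c)^{μ_i + n - i}`. The factor `y^{j-1} + y^{1-j}` takes the same value
at `x_k` and `x_k⁻¹`, while `y^n / ∏_{z ≠ y} (y - z)` equals
`± y / ((x_k - x_k⁻¹) ∏_{l ≠ k} (x_k + x_k⁻¹ - x_l - x_l⁻¹))`, with sign `+` at `y = x_k` and `-` at
`y = x_k⁻¹`. Grouping the terms of `x_k` and `x_k⁻¹` therefore factors the Jacobi–Trudi matrix as
`Aᵀ B`, where `A` is the symplectic alternant of `μ` and `B` does not depend on `μ`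
(`jacobiTrudiC_eq_mul`).

For `μ = 0` the Jacobi–Trudi matrix is upper triangular with diagonal `2, 1, …, 1`, hence has
determinant `2`. Dividing the determinant identity for `μ` by the one for `μ = 0` eliminates
`det B`, and gives the formula without any evaluation of Vandermonde-like determinants.
-/

namespace FactorialCharacter

open Polynomial Matrix

/-! ### Factorial powers -/

section FactorialPowers

variable {F : Type*} [Field F]

/-- The factorial power `(X|c)^k` as a polynomial in `X`. -/
noncomputable def factorialPoly (c : ℤ → F) (k : ℕ) : F[X] :=
  ∏ l ∈ Finset.range k, (X - C (c (l : ℤ)))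

lemma eval_factorialPoly (c : ℤ → F) (k : ℕ) (x : F) :
    (factorialPoly c k).eval x = factorialPow c x k := by
  simp [factorialPoly, factorialPow, eval_prod]

lemma monic_factorialPoly (c : ℤ → F) (k : ℕ) : (factorialPoly c k).Monic :=
  monic_prod_of_monic _ _ fun _ _ => monic_X_sub_C _

lemma natDegree_factorialPoly (c : ℤ → F) (k : ℕ) : (factorialPoly c k).natDegree = k := by
  rw [factorialPoly, natDegree_prod_of_monic _ _ fun _ _ => monic_X_sub_C _]
  simp

lemma factorialPow_shift_neg {c : ℤ → F} (hc : ∀ m : ℤ, m < 0 → c m = 0) (y : F) (r m : ℕ) :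
    factorialPow (shift (-(r : ℤ)) c) y (r + m) = y ^ r * factorialPow c y m := by
  rw [factorialPow, Finset.prod_range_add, factorialPow]
  congr 1
  · rw [Finset.prod_congr rfl (g := fun _ => y), Finset.prod_const, Finset.card_range]
    intro l hl
    rw [shift, hc _ (by have := Finset.mem_range.1 hl; omega), sub_zero]
  · refine Finset.prod_congr rfl fun l _ => ?_
    simp [shift]

end FactorialPowers

/-! ### Complete factorial symmetric polynomials as divided differences -/

section DividedDifferences

variable {F : Type*} [Field F] {N : ℕ}

lemma det_eval_eq_det_vandermonde_mul_prod_coeff (y : Fin N → F) (p : Fin N → F[X])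
    (hp : ∀ j, (p j).natDegree ≤ j) :
    (Matrix.of fun i j => (p j).eval (y i)).det =
      (vandermonde y).det * ∏ j : Fin N, (p j).coeff j := by
  rw [eval_matrixOfPolynomials_eq_vandermonde_mul_matrixOfPolynomials y p hp, det_mul,
    det_of_isUpperTriangular (matrixOfPolynomials_blockTriangular p hp)]
  rfl

lemma det_factorialPow (y : Fin N → F) (a : ℤ → F) :
    (Matrix.of fun i j : Fin N => factorialPow a (y i) j).det = (vandermonde y).det := by
  rw [det_eval_matrixOfPolynomials_eq_det_vandermonde y (fun j => factorialPoly a j)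
    (fun j => natDegree_factorialPoly a j) (fun j => monic_factorialPoly a j)]
  simp only [eval_factorialPoly]

/-- Reversing the columns of both alternants, so that the degrees increase with the column index as
in a Vandermonde matrix, leaves their ratio unchanged. -/
lemma factorialSchur_eq_div_rev (μ : Fin N → ℕ) (y : Fin N → F) (a : ℤ → F) :
    factorialSchur μ y a =
      (Matrix.of fun i j : Fin N => factorialPow a (y i) (μ j.rev + j)).det /
        (Matrix.of fun i j : Fin N => factorialPow a (y i) j).det := by
  have key : ∀ ν : Fin N → ℕ,
      (Matrix.of fun i j : Fin N => factorialPow a (y i) (ν j.rev + j)).det =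
        (Equiv.Perm.sign (Fin.revPerm (n := N)) : F) *
          (Matrix.of fun i j : Fin N => factorialPow a (y i) (ν j + (N - 1 - (j : ℕ)))).det := by
    intro ν
    rw [← det_permute']
    congr 1
    ext i j
    simp only [of_apply, submatrix_apply, id, Fin.revPerm_apply, Fin.val_rev]
    congr 2
    omega
  have key0 := key 0
  simp only [Pi.zero_apply, zero_add] at key0
  have hs : (Equiv.Perm.sign (Fin.revPerm (n := N)) : F) ≠ 0 := by
    rcases Int.units_eq_one_or (Equiv.Perm.sign (Fin.revPerm (n := N))) with h | h <;> simp [h]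
  rw [key, key0, mul_div_mul_left _ _ hs, factorialSchur]

/-- For `k = e - (N - 1) > -N`, the complete factorial symmetric polynomial is the divided
difference of `(X|a)^e` at `y_1, …, y_N`. -/
lemma completeFactorial_eq_sum {y : Fin N → F} (hy : Function.Injective y) (hN : 0 < N)
    (a : ℤ → F) (e : ℕ) :
    completeFactorial ((e : ℤ) - ((N : ℤ) - 1)) y a =
      ∑ i, factorialPow a (y i) e / ∏ j ∈ Finset.univ.erase i, (y i - y j) := by
  classical
  have hcard : (Finset.univ : Finset (Fin N)).card = N := by simp
  have hy' : Set.InjOn y (Finset.univ : Finset (Fin N)) := hy.injOn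
  by_cases he : e < N - 1
  · rw [completeFactorial, if_neg (by omega)]
    have h := Lagrange.coeff_eq_sum hy' (P := factorialPoly a e) (by
      rw [hcard]
      refine lt_of_le_of_lt degree_le_natDegree ?_
      rw [natDegree_factorialPoly]
      exact_mod_cast (by omega : e < N))
    rw [hcard, coeff_eq_zero_of_natDegree_lt (by rwa [natDegree_factorialPoly])] at h
    simpa only [eval_factorialPoly] using h
  · set P := Lagrange.interpolate Finset.univ y fun i => factorialPow a (y i) e with hP
    have hPdeg : P.degree < (N : ℕ) := by
      have h := Lagrange.degree_interpolate_lt (fun i => factorialPow a (y i) e) hy'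
      rwa [hcard] at h
    have hPeval : ∀ i, P.eval (y i) = factorialPow a (y i) e := fun i =>
      Lagrange.eval_interpolate_at_node _ hy' (Finset.mem_univ i)
    have hcoeff := Lagrange.coeff_eq_sum hy' (P := P) (by rwa [hcard])
    rw [hcard] at hcoeff
    simp only [hPeval] at hcoeff
    rw [← hcoeff, completeFactorial, if_pos (by omega), factorialSchur_eq_div_rev]
    have hV : (vandermonde y).det ≠ 0 := det_vandermonde_ne_zero_iff.2 hy
    -- Interpolating the column of degree `e` bounds the degree of column `j` by `j` throughout.
    let p : Fin N → F[X] := fun j => if (j : ℕ) = N - 1 then P else factorialPoly a j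
    have hpdeg : ∀ j, (p j).natDegree ≤ j := by
      intro j
      simp only [p]
      split_ifs with hj
      · rw [hj]
        refine natDegree_le_iff_coeff_eq_zero.2 fun m hm => ?_
        exact (degree_lt_iff_coeff_zero P N).1 hPdeg m (by omega)
      · exact (natDegree_factorialPoly a j).le
    have hnum : (Matrix.of fun i j : Fin N => factorialPow a (y i)
        ((if (j.rev : ℕ) = 0 then ((e : ℤ) - ((N : ℤ) - 1)).toNat else 0) + j)).det =
        (vandermonde y).det * P.coeff (N - 1) := by
      have hmat : (Matrix.of fun i j : Fin N => factorialPow a (y i)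
          ((if (j.rev : ℕ) = 0 then ((e : ℤ) - ((N : ℤ) - 1)).toNat else 0) + j)) =
          Matrix.of fun i j => (p j).eval (y i) := by
        ext i j
        simp only [of_apply, p]
        by_cases hj : (j : ℕ) = N - 1
        · rw [if_pos hj, if_pos (by rw [Fin.val_rev]; omega), hPeval]
          congr 1
          omega
        · rw [if_neg hj, if_neg (by rw [Fin.val_rev]; omega), eval_factorialPoly, zero_add]
      rw [hmat, det_eval_eq_det_vandermonde_mul_prod_coeff y p hpdeg,
        Finset.prod_eq_single (⟨N - 1, by omega⟩ : Fin N)]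
      · simp [p]
      · intro j _ hj
        have hj' : (j : ℕ) ≠ N - 1 := fun h => hj (Fin.ext h)
        simp only [p, if_neg hj']
        simpa only [natDegree_factorialPoly] using (monic_factorialPoly a j).coeff_natDegree
      · simp
    rw [hnum, det_factorialPow, mul_div_cancel_left₀ _ hV]

/-- At `k = 0` the two alternants coincide; they are nonzero for distinct variables. -/
lemma completeFactorial_zero {y : Fin N → F} (hy : Function.Injective y) (a : ℤ → F) :
    completeFactorial 0 y a = 1 := by
  rw [completeFactorial, if_pos le_rfl, factorialSchur_eq_div_rev]
  simp only [Int.toNat_zero, ite_self, zero_add, det_factorialPow]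
  exact div_self (det_vandermonde_ne_zero_iff.2 hy)

end DividedDifferences

/-! ### Factorization of the Jacobi–Trudi matrix -/

section Factorization

variable {F : Type*} [Field F] {n : ℕ}

/-- The alternant `x_i (x_i|c)^{μ_j + n - j} - x_i⁻¹ (x_i⁻¹|c)^{μ_j + n - j}` whose determinant is
the numerator of the factorial symplectic character. -/
def spAlternant (μ : Fin n → ℕ) (x : Fin n → F) (c : ℤ → F) : Matrix (Fin n) (Fin n) F :=
  Matrix.of fun i j : Fin n =>
      x i * factorialPow c (x i) (μ j + (n - 1 - (j : ℕ)))
        - (x i)⁻¹ * factorialPow c (x i)⁻¹ (μ j + (n - 1 - (j : ℕ)))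

/-- The factor `(x_k^{j-1} + x_k^{1-j}) / ((x_k - x_k⁻¹) ∏_{l ≠ k} (x_k + x_k⁻¹ - x_l - x_l⁻¹))`
of the Jacobi–Trudi matrix; the index `j` starts from `0` here. -/
noncomputable def spWeight (x : Fin n → F) : Matrix (Fin n) (Fin n) F :=
  Matrix.of fun k j : Fin n =>
    (x k ^ (j : ℕ) + (x k)⁻¹ ^ (j : ℕ)) /
      ((x k - (x k)⁻¹) * ∏ l ∈ Finset.univ.erase k, (x k + (x k)⁻¹ - (x l + (x l)⁻¹)))

lemma factorialSp_eq_div (μ : Fin n → ℕ) (x : Fin n → F) (c : ℤ → F) :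
    factorialSp μ x c = (spAlternant μ x c).det / (spAlternant 0 x c).det := by
  simp [factorialSp, spAlternant]

lemma withInverses_castAdd (x : Fin n → F) (k : Fin n) :
    withInverses x (Fin.castAdd n k) = x k :=
  Fin.append_left _ _ k

lemma withInverses_natAdd (x : Fin n → F) (k : Fin n) :
    withInverses x (Fin.natAdd n k) = (x k)⁻¹ :=
  Fin.append_right _ _ k

lemma mul_prod_sub_mul_sub_inv {x : Fin n → F} (hx : ∀ i, x i ≠ 0) {y : F} (hy : y ≠ 0)
    (k : Fin n) :
    y * ∏ l ∈ Finset.univ.erase k, ((y - x l) * (y - (x l)⁻¹)) =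
      y ^ n * ∏ l ∈ Finset.univ.erase k, (y + y⁻¹ - (x l + (x l)⁻¹)) := by
  have hn : n = (n - 1) + 1 := by have := k.2; omega
  have hcard : (Finset.univ.erase k).card = n - 1 := by simp
  have h : ∀ l, (y - x l) * (y - (x l)⁻¹) = y * (y + y⁻¹ - (x l + (x l)⁻¹)) := fun l => by
    have := hx l
    field_simp
    ring
  simp only [h, Finset.prod_mul_distrib, Finset.prod_const, hcard]
  rw [← mul_assoc, ← pow_succ', ← hn]

lemma prod_sub_withInverses_castAdd {x : Fin n → F} (hx : ∀ i, x i ≠ 0) (k : Fin n) :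
    x k * ∏ j ∈ Finset.univ.erase (Fin.castAdd n k),
        (withInverses x (Fin.castAdd n k) - withInverses x j) =
      x k ^ n * ((x k - (x k)⁻¹) *
        ∏ l ∈ Finset.univ.erase k, (x k + (x k)⁻¹ - (x l + (x l)⁻¹))) := by
  have hne : ∀ l, Fin.natAdd n l ≠ Fin.castAdd n k := fun l h => by
    have := congrArg Fin.val h
    have := k.2
    simp only [Fin.val_natAdd, Fin.val_castAdd] at *
    omega
  rw [← Finset.filter_ne', Finset.prod_filter, Fin.prod_univ_add]
  simp only [withInverses_castAdd, withInverses_natAdd, ne_eq, Fin.castAdd_inj, hne,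
    not_false_eq_true, if_true]
  rw [← Finset.prod_filter, Finset.filter_ne', ← Finset.mul_prod_erase _ _ (Finset.mem_univ k),
    mul_left_comm (x k ^ n), ← mul_prod_sub_mul_sub_inv hx (hx k) k, Finset.prod_mul_distrib]
  ring

lemma prod_sub_withInverses_natAdd {x : Fin n → F} (hx : ∀ i, x i ≠ 0) (k : Fin n) :
    (x k)⁻¹ * ∏ j ∈ Finset.univ.erase (Fin.natAdd n k),
        (withInverses x (Fin.natAdd n k) - withInverses x j) =
      -((x k)⁻¹ ^ n * ((x k - (x k)⁻¹) *
        ∏ l ∈ Finset.univ.erase k, (x k + (x k)⁻¹ - (x l + (x l)⁻¹)))) := by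
  have hne : ∀ l, Fin.castAdd n l ≠ Fin.natAdd n k := fun l h => by
    have := congrArg Fin.val h
    have := l.2
    simp only [Fin.val_natAdd, Fin.val_castAdd] at *
    omega
  have h := mul_prod_sub_mul_sub_inv hx (inv_ne_zero (hx k)) k
  rw [inv_inv, add_comm (x k)⁻¹ (x k), Finset.prod_mul_distrib] at h
  rw [← Finset.filter_ne', Finset.prod_filter, Fin.prod_univ_add]
  simp only [withInverses_castAdd, withInverses_natAdd, ne_eq, Fin.natAdd_inj, hne,
    not_false_eq_true, if_true]
  rw [← Finset.prod_filter, Finset.filter_ne', ← Finset.mul_prod_erase _ _ (Finset.mem_univ k),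
    mul_left_comm ((x k)⁻¹ ^ n), ← h]
  ring

lemma completeFactorial_shift_neg {x : Fin n → F} (hx : Function.Injective (withInverses x))
    (hn : 1 ≤ n) {c : ℤ → F} (hc : ∀ m : ℤ, m < 0 → c m = 0) {k s : ℤ} (r m : ℕ)
    (hs : s = -(r : ℤ)) (hk : k = r + m - (2 * n - 1)) :
    completeFactorial k (withInverses x) (shift s c) =
      ∑ i, withInverses x i ^ r * factorialPow c (withInverses x i) m /
        ∏ j ∈ Finset.univ.erase i, (withInverses x i - withInverses x j) := by
  have hk' : k = ((r + m : ℕ) : ℤ) - (((n + n : ℕ) : ℤ) - 1) := by push_cast; omega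
  rw [hs, hk', completeFactorial_eq_sum hx (by omega)]
  simp only [factorialPow_shift_neg hc]

lemma jacobiTrudiC_eq_mul {x : Fin n → F} (hx0 : ∀ i, x i ≠ 0)
    (hx : Function.Injective (withInverses x)) (μ : Fin n → ℕ) {c : ℤ → F}
    (hc : ∀ m : ℤ, m < 0 → c m = 0) :
    jacobiTrudiC μ x c = (spAlternant μ x c)ᵀ * spWeight x := by
  ext i j
  have hi := i.2
  have hj := j.2
  rw [mul_apply, jacobiTrudiC, of_apply,
    completeFactorial_shift_neg hx (by omega) hc (n + j) (μ i + (n - 1 - i)) (by omega)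
      (by omega),
    completeFactorial_shift_neg hx (by omega) hc (n - j) (μ i + (n - 1 - i)) (by omega)
      (by omega),
    ← Finset.sum_add_distrib, Fin.sum_univ_add, ← Finset.sum_add_distrib]
  refine Finset.sum_congr rfl fun k _ => ?_
  have h1 := prod_sub_withInverses_castAdd hx0 k
  have h2 := prod_sub_withInverses_natAdd hx0 k
  have hP1 : ∏ j ∈ Finset.univ.erase (Fin.castAdd n k),
      (withInverses x (Fin.castAdd n k) - withInverses x j) ≠ 0 :=
    Finset.prod_ne_zero_iff.2 fun l hl => sub_ne_zero.2 (hx.ne (Finset.ne_of_mem_erase hl).symm)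
  have hP2 : ∏ j ∈ Finset.univ.erase (Fin.natAdd n k),
      (withInverses x (Fin.natAdd n k) - withInverses x j) ≠ 0 :=
    Finset.prod_ne_zero_iff.2 fun l hl => sub_ne_zero.2 (hx.ne (Finset.ne_of_mem_erase hl).symm)
  have hk := hx0 k
  simp only [transpose_apply, spAlternant, spWeight, of_apply]
  generalize hD : (x k - (x k)⁻¹) *
    ∏ l ∈ Finset.univ.erase k, (x k + (x k)⁻¹ - (x l + (x l)⁻¹)) = D at *
  have hD0 : D ≠ 0 := by
    rintro rfl
    rw [mul_zero] at h1
    exact mul_ne_zero hk hP1 h1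
  generalize ∏ j ∈ Finset.univ.erase (Fin.castAdd n k),
      (withInverses x (Fin.castAdd n k) - withInverses x j) = P1 at *
  generalize ∏ j ∈ Finset.univ.erase (Fin.natAdd n k),
      (withInverses x (Fin.natAdd n k) - withInverses x j) = P2 at *
  rw [withInverses_castAdd, withInverses_natAdd]
  -- The two exponents `n + j` and `n - j` combine into the factor `y^n (y^j + y⁻¹^j)`.
  have hpow : ∀ y : F, y ≠ 0 → y ^ (n - (j : ℕ)) = y ^ n * y⁻¹ ^ (j : ℕ) := fun y hy => by
    rw [pow_sub₀ y hy hj.le, inv_pow]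
  rw [hpow _ hk, hpow _ (inv_ne_zero hk), inv_inv, pow_add, pow_add]
  have h1' : x k ^ n / P1 = x k / D := by
    rw [div_eq_div_iff hP1 hD0, h1]
  have h2' : (x k)⁻¹ ^ n / P2 = -(x k)⁻¹ / D := by
    rw [div_eq_div_iff hP2 hD0, neg_mul, h2, neg_neg]
  generalize factorialPow c (x k) _ = f
  generalize factorialPow c (x k)⁻¹ _ = g
  linear_combination (x k ^ (j : ℕ) + (x k)⁻¹ ^ (j : ℕ)) * f * h1' +
    (x k ^ (j : ℕ) + (x k)⁻¹ ^ (j : ℕ)) * g * h2'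

/-- For the empty partition the Jacobi–Trudi matrix is upper triangular, with diagonal
`2, 1, …, 1`: the two summands of an entry coincide in the first column. -/
lemma det_jacobiTrudiC_zero {x : Fin n → F} (hn : 1 ≤ n)
    (hx : Function.Injective (withInverses x)) (c : ℤ → F) :
    (jacobiTrudiC 0 x c).det = 2 := by
  rw [det_of_isUpperTriangular, Finset.prod_eq_single (⟨0, hn⟩ : Fin n)]
  · simp only [jacobiTrudiC, of_apply, Pi.zero_apply]
    norm_num [completeFactorial_zero hx]
  · intro i _ hi
    have hi' : (i : ℕ) ≠ 0 := fun h => hi (Fin.ext h)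
    have e : ((0 : Fin n → ℕ) i : ℤ) - ((i : ℤ) + 1) + ((i : ℤ) + 1) = 0 := by simp
    rw [jacobiTrudiC, of_apply, e, completeFactorial_zero hx, completeFactorial,
      if_neg (by simp; omega), add_zero]
  · simp
  · intro i j hij
    have hij' : (j : ℕ) < i := hij
    rw [jacobiTrudiC, of_apply, completeFactorial, completeFactorial, if_neg (by simp; omega),
      if_neg (by simp; omega), add_zero]

/-- The Jacobi–Trudi formula for the factorial symplectic character, for elements `x_i ≠ 0` of any
field of characteristic `≠ 2` such that `x_1, …, x_n, x_1⁻¹, …, x_n⁻¹` are distinct. -/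
theorem factorialSp_eq_half_det_jacobiTrudiC (h2 : (2 : F) ≠ 0) (hn : 1 ≤ n) {x : Fin n → F}
    (hx0 : ∀ i, x i ≠ 0) (hx : Function.Injective (withInverses x)) (μ : Fin n → ℕ) {c : ℤ → F}
    (hc : ∀ m : ℤ, m < 0 → c m = 0) :
    factorialSp μ x c = 1 / 2 * (jacobiTrudiC μ x c).det := by
  have h0 := det_jacobiTrudiC_zero hn hx c
  rw [jacobiTrudiC_eq_mul hx0 hx 0 hc, det_mul, det_transpose] at h0
  rw [factorialSp_eq_div, jacobiTrudiC_eq_mul hx0 hx μ hc, det_mul, det_transpose]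
  have hA : (spAlternant 0 x c).det ≠ 0 := by
    intro h
    rw [h, zero_mul] at h0
    exact h2 h0.symm
  rw [div_eq_iff hA]
  field_simp
  linear_combination -(spAlternant μ x c).det * h0

end Factorization

/-! ### The indeterminates -/

section Indeterminates

variable (K : Type*) [Field K] (n : ℕ)

lemma indeterminate_ne_zero (i : Fin n) : indeterminate K n i ≠ 0 := by
  rw [indeterminate, Ne, IsFractionRing.to_map_eq_zero_iff]
  exact MvPolynomial.X_ne_zero i

lemma indeterminate_injective : Function.Injective (indeterminate K n) :=
  (IsFractionRing.injective _ _).comp MvPolynomial.X_injective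

lemma indeterminate_mul_ne_one (i j : Fin n) : indeterminate K n i * indeterminate K n j ≠ 1 := by
  rw [indeterminate, indeterminate, ← map_mul,
    ← map_one (algebraMap (MvPolynomial (Fin n) K) (RationalFunctions K n)),
    (IsFractionRing.injective (MvPolynomial (Fin n) K) (RationalFunctions K n)).ne_iff]
  intro h
  simpa using congrArg (MvPolynomial.eval (0 : Fin n → K)) h

lemma withInverses_indeterminate_injective :
    Function.Injective (withInverses (indeterminate K n)) := by
  rw [withInverses, Fin.append_injective_iff]
  refine ⟨indeterminate_injective K n, inv_injective.comp (indeterminate_injective K n), ?_⟩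
  intro i j h
  refine indeterminate_mul_ne_one K n i j ?_
  rw [h, inv_mul_cancel₀ (indeterminate_ne_zero K n j)]

end Indeterminates

end FactorialCharacter

theorem mainTheorem5 {K : Type*} [Field K] [CharZero K] (n : ℕ) (hn : 1 ≤ n)
    (μ : Fin n → ℕ) (hμ : Antitone μ) (c : ℤ → K) (hc : ∀ m : ℤ, m < 0 → c m = 0) :
    FactorialCharacter.factorialSp μ (FactorialCharacter.indeterminate K n)
        (FactorialCharacter.constSeq n c) =
      1 / 2 * (FactorialCharacter.jacobiTrudiC μ (FactorialCharacter.indeterminate K n)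
        (FactorialCharacter.constSeq n c)).det := by
  have h2 : (2 : FactorialCharacter.RationalFunctions K n) ≠ 0 := by
    have h := (algebraMap K (FactorialCharacter.RationalFunctions K n)).injective.ne
      (two_ne_zero (α := K))
    simpa only [map_ofNat, map_zero] using h
  refine FactorialCharacter.factorialSp_eq_half_det_jacobiTrudiC h2 hn
    (FactorialCharacter.indeterminate_ne_zero K n)
    (FactorialCharacter.withInverses_indeterminate_injective K n) μ fun m hm => ?_
  simp [FactorialCharacter.constSeq, hc m hm]
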